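/- Let $K$ be a field. An \emph{alternating box} $(m,n)^{\varepsilon}$ ($m,n\ge 0$, $m+n$ even, $\varepsilon\in\{+,-\}$) is a rectangle with $m$ pins on its lower and $n$ pins on its upper edge, the pins of each edge being oriented alternately, starting from the left with $\varepsilon$ ($+$ is upward, $-$ is downward); for $m=n=0$ the sign is part of the datum. An \emph{alternating pod} $X_1\times\dots\times X_k\to Y$ is a planar diagram, up to planar isotopy, of oriented non-crossing strings (loops are allowed) inside the outer box $Y$ with numbered inner boxes $X_1,\dots,X_k$, in which every pin is the end of exactly one string, such that orientations agree at the pins and the regions can be given signs, changing across every string, so that a string going upward has a region of sign $+$ on its left, and the region at the left side of each (inner or outer) box has the sign of that box. With plugging of diagrams into inner boxes as composition, alternating pods form a multicategory $\mathcal{AD}$; let $\mathcal{AD}_+$ be its full submulticategory on the boxes $(m,n)^+$. A \emph{representation} of one of these multicategories assigns to every object $X$ a $K$-vector space $P_X$ and to every morphism $T:X_1\times\dots\times X_k\to Y$ a multilinear map $\pi_T:P_{X_1}\times\dots\times P_{X_k}\to P_Y$, compatibly with identities and plugging. We write $P^{\pm}_{m,n}=P_{(m,n)^{\pm}}$. We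 say that \emph{anticlockwise loops have value $d\in K$} if $\pi_T=d\,\pi_{T_0}$ whenever the pod $T_0$ is obtained from the pod $T$ by removing one anticlockwise loop that bounds a disk containing no other part of $T$ (so $\pi_T=d^{\,l}\pi_{T_0}$ if $l$ such loops are removed). Let $d\neq 0$, and let $(\pi^+,P^+)$ be a representation of $\mathcal{AD}_+$ in which anticlockwise loops have value $d$. Then $(\pi^+,P^+)$ extends to a representation $(\pi,P)$ of $\mathcal{AD}$ in which anticlockwise loops have value $d$, that is, there is such a representation together with an isomorphism of its restriction to $\mathcal{AD}_+$ with $(\pi^+,P^+)$. The extension is unique: for any other such extension there is exactly one isomorphism of representations of $\mathcal{AD}$ from $(\pi,P)$ to it that is compatible with the identifications of the restrictions with $(\pi^+,P^+)$. Moreover, for all $m,n$ with $m+n$ even, the map $P^-_{m,n}\to P^+_{m+1,n+1}$, $a\mapsto 1\otimes a$ (put an upward vertical string on the left of $a$), is injective, and $d^{-1}\pi^+_{1\otimes C}$ is a projection of $P^+_{m+1,n+1}$ onto its image, where $1\otimes C:(m+1,n+1)^+\to(m+1,n+1)^+$ is the pod consisting of an upward vertical string and, on its right, the inner box with its leftmost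 lower and leftmost upper pins joined by an arc passing on the left of the box. -/

import Mathlib

/-!
# The multicategory of alternating planar oriented diagrams, and its representations

A planar diagram is recorded in general position: reading it from bottom to top it is a finite
list of layers, each of which is a local minimum of a string (`cup`), a local maximum of a
string (`cap`) or an (upright) inner box, placed to the right of `pos` vertical strands.
Planar isotopy is the equivalence relation generated by the usual planar moves.

Alternation: on every horizontal line the strings are oriented alternately.  Equivalently the
regions carry signs, the sign changes across every string, and a string is oriented upwards
exactly when the region on its left has sign `+`.  The sign of a box is the sign of the region at
its left side, that is the orientation of its leftmost strings on the lower and on the upper edge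
(for a box without pins it is the sign of the region around it).
-/

namespace AltPod

/-- The objects: boxes with `lower` pins on the lower edge and `upper` pins on the upper edge,
an even number in total, decorated alternately and circularly, the decoration of both edges
starting from the left with `sign` (`true` is `+`, i.e. upward, `false` is `-`, i.e. downward). -/
structure Box where
  sign : Bool
  lower : ℕ
  upper : ℕ
  even : Even (lower + upper)

/-- The `p`-th term (`p = 0, 1, …`) of the alternating sequence that starts with `ε`. It is the
sign of the region to the right of `p` strands, and the orientation of the strand that follows
them, if the leftmost region has sign `ε`. -/
def altSign (ε : Bool) (p : ℕ) : Bool := xor ε p.bodd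

/-- What a layer contains: an arc `∪`, an arc `∩`, or the inner box with number `j`. -/
inductive Gen (k : ℕ) : Type
  | cup : Gen k
  | cap : Gen k
  | box (j : Fin k) : Gen k
  deriving DecidableEq

/-- A layer: `gen`, with exactly `pos` vertical strands on its left. -/
structure Layer (k : ℕ) : Type where
  pos : ℕ
  gen : Gen k

/-- The number of strands entering from below; `X` lists the types of the inner boxes. -/
def Gen.src {k : ℕ} (X : Fin k → Box) : Gen k → ℕ
  | .cup => 0
  | .cap => 2
  | .box j => (X j).lower

/-- The number of strands leaving above. -/
def Gen.tgt {k : ℕ} (X : Fin k → Box) : Gen k → ℕ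
  | .cup => 2
  | .cap => 0
  | .box j => (X j).upper

/-- A generator may be put into a region of sign `ε` (for an inner box the signs have to agree). -/
def Gen.Fits {k : ℕ} (X : Fin k → Box) (ε : Bool) : Gen k → Prop
  | .cup => True
  | .cap => True
  | .box j => (X j).sign = ε

/-- `Runs X ε m w n`: the layers `w`, stacked from bottom to top on `m` strands with leftmost
region of sign `ε`, fit together and end with `n` strands. -/
def Runs {k : ℕ} (X : Fin k → Box) (ε : Bool) : ℕ → List (Layer k) → ℕ → Prop
  | m, [], n => m = n
  | m, L :: w, n =>
      L.pos + L.gen.src X ≤ m ∧ L.gen.Fits X (altSign ε L.pos) ∧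
        Runs X ε (m - L.gen.src X + L.gen.tgt X) w n

/-- How often the inner box `j` occurs. -/
def boxCount {k : ℕ} (w : List (Layer k)) (j : Fin k) : ℕ :=
  w.countP fun L => decide (L.gen = Gen.box j)

/-- Add `p` vertical strands on the left. -/
def shift {k : ℕ} (p : ℕ) (w : List (Layer k)) : List (Layer k) :=
  w.map fun L => ⟨p + L.pos, L.gen⟩

/-- `m` nested arcs `∪`, with `p` strands on their left. -/
def cups {k : ℕ} (p m : ℕ) : List (Layer k) :=
  (List.range m).map fun i => ⟨p + i, Gen.cup⟩

/-- `n` nested arcs `∩`, with `p` strands on their left. -/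
def caps {k : ℕ} (p n : ℕ) : List (Layer k) :=
  (List.range n).reverse.map fun i => ⟨p + i, Gen.cap⟩

/-- The elementary planar isotopies.
* `slide`: two subdiagrams side by side (with `r` strands in between) are moved vertically past
  each other;
* `snake_left`, `snake_right`: a string is pulled straight;
* `turn`: a subdiagram turned upside down by a rotation through `π` is the same for the
  two directions of the rotation. -/
inductive Move {k : ℕ} (X : Fin k → Box) : List (Layer k) → List (Layer k) → Prop
  | slide (ε : Bool) (A B : List (Layer k)) (p m n r : ℕ) (hA : Runs X ε m A n) :
      Move X (shift p A ++ shift (p + n + r) B) (shift (p + m + r) B ++ shift p A)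
  | snake_left (p : ℕ) : Move X [⟨p + 1, Gen.cup⟩, ⟨p, Gen.cap⟩] []
  | snake_right (p : ℕ) : Move X [⟨p, Gen.cup⟩, ⟨p + 1, Gen.cap⟩] []
  | turn (ε : Bool) (A : List (Layer k)) (p m n : ℕ) (hA : Runs X ε m A n) :
      Move X (cups (p + n) m ++ shift (p + n) A ++ caps p n)
        (cups p m ++ shift (p + m) A ++ caps (p + m) n)

/-- An alternating diagram in the outer box `Y` with inner boxes `X 0, …, X (k - 1)`, each
occurring exactly once. -/
structure Diagram {k : ℕ} (X : Fin k → Box) (Y : Box) : Type where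
  word : List (Layer k)
  runs : Runs X Y.sign Y.lower word Y.upper
  once : ∀ j, boxCount word j = 1

/-- One elementary isotopy inside a diagram. -/
def Step {k : ℕ} {X : Fin k → Box} {Y : Box} (D D' : Diagram X Y) : Prop :=
  ∃ a x y b, D.word = a ++ x ++ b ∧ D'.word = a ++ y ++ b ∧ Move X x y

/-- The morphisms `X 0 × ⋯ × X (k - 1) → Y`: alternating pods, i.e. alternating diagrams up to
planar isotopy. -/
def Pod {k : ℕ} (X : Fin k → Box) (Y : Box) : Type :=
  Quot (Step (X := X) (Y := Y))

def Diagram.pod {k : ℕ} {X : Fin k → Box} {Y : Box} (D : Diagram X Y) : Pod X Y :=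
  Quot.mk _ D

/-! ### Identities and plugging -/

/-- The identity diagram: the inner box and vertical strands. -/
def Diagram.id (Y : Box) : Diagram (fun _ : Fin 1 => Y) Y where
  word := [⟨0, Gen.box 0⟩]
  runs := by simp [Runs, Gen.src, Gen.tgt, Gen.Fits, altSign]
  once := by intro j; simp [boxCount, Subsingleton.elim j 0]

/-- The types of the inner boxes after plugging, in lexicographic order. -/
abbrev plugBoxes {O : Type*} {k : ℕ} {κ : Fin k → ℕ} (Z : ∀ j, Fin (κ j) → O) :
    Fin (∑ j, κ j) → O :=
  fun s => Z (finSigmaFinEquiv.symm s).1 (finSigmaFinEquiv.symm s).2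

def Gen.relabel {k l : ℕ} (f : Fin k → Fin l) : Gen k → Gen l
  | .cup => .cup
  | .cap => .cap
  | .box j => .box (f j)

def relabel {k l : ℕ} (f : Fin k → Fin l) (w : List (Layer k)) : List (Layer l) :=
  w.map fun L => ⟨L.pos, L.gen.relabel f⟩

/-- Replace a layer consisting of the inner box `j` by the diagram `W j`. -/
def plugLayer {k : ℕ} {κ : Fin k → ℕ} (W : ∀ j, List (Layer (κ j))) (L : Layer k) :
    List (Layer (∑ j, κ j)) :=
  match L.gen with
  | .cup => [⟨L.pos, Gen.cup⟩]
  | .cap => [⟨L.pos, Gen.cap⟩]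
  | .box j => shift L.pos (relabel (fun i => finSigmaFinEquiv ⟨j, i⟩) (W j))

def plugWord {k : ℕ} {κ : Fin k → ℕ} (W : ∀ j, List (Layer (κ j))) (w : List (Layer k)) :
    List (Layer (∑ j, κ j)) :=
  w.flatMap (plugLayer W)

section facts

theorem altSign_add (ε : Bool) (p q : ℕ) : altSign ε (p + q) = altSign (altSign ε p) q := by
  simp [altSign, Nat.bodd_add]

theorem runs_append {k : ℕ} {X : Fin k → Box} {ε : Bool} (v : List (Layer k)) :
    ∀ (u : List (Layer k)) (m n l : ℕ), Runs X ε m u n → Runs X ε n v l →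
      Runs X ε m (u ++ v) l
  | [], m, n, l, h, h' => by simp only [Runs] at h; subst h; simpa using h'
  | L :: u, m, n, l, h, h' => by
      simp only [Runs, List.cons_append] at h ⊢
      exact ⟨h.1, h.2.1, runs_append v u _ _ _ h.2.2 h'⟩

theorem runs_shift {k : ℕ} {X : Fin k → Box} {ε : Bool} (p q : ℕ) :
    ∀ (w : List (Layer k)) (m n : ℕ), Runs X (altSign ε p) m w n →
      Runs X ε (p + m + q) (shift p w) (p + n + q)
  | [], m, n, h => by simp only [Runs] at h; subst h; simp [shift, Runs]
  | L :: w, m, n, h => by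
      simp only [Runs] at h
      obtain ⟨h1, h2, h3⟩ := h
      have ih := runs_shift p q w _ _ h3
      simp only [shift, List.map_cons, Runs, altSign_add] at ih ⊢
      refine ⟨by omega, h2, ?_⟩
      have e : p + m + q - L.gen.src X + L.gen.tgt X
          = p + (m - L.gen.src X + L.gen.tgt X) + q := by omega
      rw [e]; exact ih

theorem runs_relabel {k l : ℕ} {X : Fin k → Box} {X' : Fin l → Box} (f : Fin k → Fin l)
    (hf : ∀ j, X' (f j) = X j) {ε : Bool} :
    ∀ (w : List (Layer k)) (m n : ℕ), Runs X ε m w n → Runs X' ε m (relabel f w) n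
  | [], m, n, h => h
  | ⟨p, g⟩ :: w, m, n, h => by
      simp only [relabel, List.map_cons, Runs] at h ⊢
      have ih := runs_relabel f hf w _ _ h.2.2
      refine ⟨?_, ?_, ?_⟩
      · cases g <;> simpa [Gen.relabel, Gen.src, hf] using h.1
      · cases g
        · trivial
        · trivial
        · simpa [Gen.relabel, Gen.Fits, hf] using h.2.1
      · cases g <;> simpa [Gen.relabel, Gen.src, Gen.tgt, hf, relabel] using ih

variable {k : ℕ} {κ : Fin k → ℕ}

theorem plugBoxes_apply {O : Type*} (Z : ∀ j, Fin (κ j) → O) (j : Fin k) (i : Fin (κ j)) :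
    plugBoxes Z (finSigmaFinEquiv ⟨j, i⟩) = Z j i := by
  have h : ∀ s : (Σ j, Fin (κ j)), s = ⟨j, i⟩ → Z s.1 s.2 = Z j i := by
    rintro _ rfl; rfl
  exact h _ (Equiv.symm_apply_apply _ _)

theorem runs_plugWord {X : Fin k → Box} {Z : ∀ j, Fin (κ j) → Box}
    {W : ∀ j, List (Layer (κ j))}
    (hW : ∀ j, Runs (Z j) (X j).sign (X j).lower (W j) (X j).upper) {ε : Bool} :
    ∀ (w : List (Layer k)) (m n : ℕ), Runs X ε m w n →
      Runs (plugBoxes Z) ε m (plugWord W w) n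
  | [], m, n, h => h
  | ⟨p, g⟩ :: w, m, n, h => by
      simp only [Runs] at h
      obtain ⟨h1, h2, h3⟩ := h
      have ih := runs_plugWord hW w _ _ h3
      rw [plugWord, List.flatMap_cons]
      refine runs_append _ _ _ _ _ ?_ ih
      cases g with
      | cup => simpa [plugLayer, Runs, Gen.src, Gen.tgt, Gen.Fits] using h1
      | cap => simpa [plugLayer, Runs, Gen.src, Gen.tgt, Gen.Fits] using h1
      | box j =>
        simp only [Gen.src, Gen.tgt, Gen.Fits] at h1 h2 ⊢
        have hj := runs_relabel (X' := plugBoxes Z) (fun i => finSigmaFinEquiv ⟨j, i⟩)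
          (fun i => plugBoxes_apply Z j i) _ _ _ (hW j)
        rw [h2] at hj
        have := runs_shift p (m - (p + (X j).lower)) _ _ _ hj
        have e1 : p + (X j).lower + (m - (p + (X j).lower)) = m := by omega
        have e2 : p + (X j).upper + (m - (p + (X j).lower))
            = m - (X j).lower + (X j).upper := by omega
        rw [e1, e2] at this
        exact this

theorem boxCount_append (u v : List (Layer k)) (j : Fin k) :
    boxCount (u ++ v) j = boxCount u j + boxCount v j := by
  simp [boxCount, List.countP_append]

theorem boxCount_plugLayer (W : ∀ j, List (Layer (κ j))) (L : Layer k) (j : Fin k)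
    (i : Fin (κ j)) :
    boxCount (plugLayer W L) (finSigmaFinEquiv ⟨j, i⟩) = boxCount [L] j * boxCount (W j) i := by
  obtain ⟨p, g⟩ := L
  cases g with
  | cup => simp [plugLayer, boxCount]
  | cap => simp [plugLayer, boxCount]
  | box j' =>
    simp only [plugLayer, boxCount, shift, relabel, List.map_map, List.countP_map]
    by_cases hj : j' = j
    · subst hj
      simp only [List.countP_singleton, decide_true, if_true, one_mul]
      refine List.countP_congr ?_
      rintro ⟨q, g⟩ -
      cases g <;> simp [Gen.relabel]
    · simp only [List.countP_singleton, Gen.box.injEq, hj, decide_false, Bool.false_eq_true,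
        if_false, zero_mul, List.countP_eq_zero]
      rintro ⟨q, g⟩ -
      cases g <;> simp [Gen.relabel, hj]

theorem boxCount_plugWord (W : ∀ j, List (Layer (κ j))) (j : Fin k) (i : Fin (κ j)) :
    ∀ w : List (Layer k),
      boxCount (plugWord W w) (finSigmaFinEquiv ⟨j, i⟩) = boxCount w j * boxCount (W j) i
  | [] => by simp [plugWord, boxCount]
  | L :: w => by
      have ih := boxCount_plugWord W j i w
      have hL := boxCount_plugLayer W L j i
      rw [plugWord, List.flatMap_cons, boxCount_append, hL]
      rw [plugWord] at ih
      rw [ih, ← add_mul, ← boxCount_append]; rfl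

end facts

/-- Plugging the diagrams `E j` into the inner boxes of `D`. -/
def Diagram.plug {k : ℕ} {κ : Fin k → ℕ} {X : Fin k → Box} {Y : Box}
    {Z : ∀ j, Fin (κ j) → Box} (D : Diagram X Y) (E : ∀ j, Diagram (Z j) (X j)) :
    Diagram (plugBoxes Z) Y where
  word := plugWord (fun j => (E j).word) D.word
  runs := runs_plugWord (fun j => (E j).runs) _ _ _ D.runs
  once := by
    intro s
    obtain ⟨⟨j, i⟩, rfl⟩ := finSigmaFinEquiv.surjective s
    rw [boxCount_plugWord, D.once, (E j).once]

def Pod.id (Y : Box) : Pod (fun _ : Fin 1 => Y) Y := (Diagram.id Y).pod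

/-- Plugging of pods, computed on representatives (see `Pod.plug_pod`). -/
noncomputable def Pod.plug {k : ℕ} {κ : Fin k → ℕ} {X : Fin k → Box} {Y : Box}
    {Z : ∀ j, Fin (κ j) → Box} (T : Pod X Y) (S : ∀ j, Pod (Z j) (X j)) : Pod (plugBoxes Z) Y :=
  ((Quot.out T).plug fun j => Quot.out (S j)).pod

section welldefined

variable {k : ℕ} {κ : Fin k → ℕ}

theorem shift_append (p : ℕ) (u v : List (Layer k)) : shift p (u ++ v) = shift p u ++ shift p v :=
  List.map_append

theorem shift_shift (p q : ℕ) (u : List (Layer k)) : shift p (shift q u) = shift (p + q) u := by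
  simp [shift, Function.comp_def, add_assoc]

theorem shift_cups (p q m : ℕ) : shift p (cups q m : List (Layer k)) = cups (p + q) m := by
  simp [shift, cups, Function.comp_def, add_assoc]

theorem shift_caps (p q m : ℕ) : shift p (caps q m : List (Layer k)) = caps (p + q) m := by
  simp [shift, caps, Function.comp_def, add_assoc]

theorem Move.shift {X : Fin k → Box} {x y : List (Layer k)} (h : Move X x y) (q : ℕ) :
    Move X (AltPod.shift q x) (AltPod.shift q y) := by
  cases h with
  | slide ε A B p m n r hA =>
    simp only [shift_append, shift_shift]
    have := Move.slide ε A B (q + p) m n r hA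
    simpa only [add_assoc] using this
  | snake_left p => exact Move.snake_left (q + p)
  | snake_right p => exact Move.snake_right (q + p)
  | turn ε A p m n hA =>
    simp only [shift_append, shift_shift, shift_cups, shift_caps]
    have := Move.turn ε A (q + p) m n hA
    simpa only [add_assoc] using this

theorem Move.relabel {l : ℕ} {X : Fin k → Box} {X' : Fin l → Box} (f : Fin k → Fin l)
    (hf : ∀ j, X' (f j) = X j) {x y : List (Layer k)} (h : Move X x y) :
    Move X' (AltPod.relabel f x) (AltPod.relabel f y) := by
  have hs : ∀ p (w : List (Layer k)),
      AltPod.relabel f (AltPod.shift p w) = AltPod.shift p (AltPod.relabel f w) := by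
    intro p w; simp [AltPod.relabel, AltPod.shift, Function.comp_def]
  have ha : ∀ u v : List (Layer k),
      AltPod.relabel f (u ++ v) = AltPod.relabel f u ++ AltPod.relabel f v :=
    fun u v => List.map_append
  have hu : ∀ p m, AltPod.relabel f (cups p m) = cups p m := by
    intro p m; simp [AltPod.relabel, cups, Function.comp_def, Gen.relabel]
  have hc : ∀ p m, AltPod.relabel f (caps p m) = caps p m := by
    intro p m; simp [AltPod.relabel, caps, Function.comp_def, Gen.relabel]
  cases h with
  | slide ε A B p m n r hA =>
    simp only [ha, hs]; exact Move.slide ε _ _ p m n r (runs_relabel f hf _ _ _ hA)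
  | snake_left p => exact Move.snake_left p
  | snake_right p => exact Move.snake_right p
  | turn ε A p m n hA =>
    simp only [ha, hs, hu, hc]; exact Move.turn ε _ p m n (runs_relabel f hf _ _ _ hA)

theorem plugWord_append (W : ∀ j, List (Layer (κ j))) (u v : List (Layer k)) :
    plugWord W (u ++ v) = plugWord W u ++ plugWord W v := List.flatMap_append

theorem plugWord_shift (W : ∀ j, List (Layer (κ j))) (p : ℕ) :
    ∀ u : List (Layer k), plugWord W (shift p u) = shift p (plugWord W u)
  | [] => rfl
  | ⟨q, g⟩ :: u => by
      have ih := plugWord_shift W p u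
      have h1 : shift p (⟨q, g⟩ :: u) = [⟨p + q, g⟩] ++ shift p u := rfl
      have h2 : (⟨q, g⟩ :: u : List (Layer k)) = [⟨q, g⟩] ++ u := rfl
      rw [h1, h2, plugWord_append, plugWord_append, shift_append, ih]
      congr 1
      cases g with
      | cup => rfl
      | cap => rfl
      | box j => simp [plugWord, plugLayer, shift_shift]

theorem plugWord_cups (W : ∀ j, List (Layer (κ j))) (p m : ℕ) :
    plugWord W (cups p m) = cups p m := by
  simp only [plugWord, cups, List.flatMap_map]
  induction List.range m with
  | nil => rfl
  | cons a l ih => simp only [List.flatMap_cons, ih]; rfl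

theorem plugWord_caps (W : ∀ j, List (Layer (κ j))) (p m : ℕ) :
    plugWord W (caps p m) = caps p m := by
  simp only [plugWord, caps, List.flatMap_map]
  induction (List.range m).reverse with
  | nil => rfl
  | cons a l ih => simp only [List.flatMap_cons, ih]; rfl

theorem Move.plugWord {X : Fin k → Box} {Z : ∀ j, Fin (κ j) → Box}
    {W : ∀ j, List (Layer (κ j))}
    (hW : ∀ j, Runs (Z j) (X j).sign (X j).lower (W j) (X j).upper)
    {x y : List (Layer k)} (h : Move X x y) :
    Move (plugBoxes Z) (AltPod.plugWord W x) (AltPod.plugWord W y) := by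
  cases h with
  | slide ε A B p m n r hA =>
    simp only [plugWord_append, plugWord_shift]
    exact Move.slide ε _ _ p m n r (runs_plugWord hW _ _ _ hA)
  | snake_left p => exact Move.snake_left p
  | snake_right p => exact Move.snake_right p
  | turn ε A p m n hA =>
    simp only [plugWord_append, plugWord_shift, plugWord_cups, plugWord_caps]
    exact Move.turn ε _ p m n (runs_plugWord hW _ _ _ hA)

variable {X : Fin k → Box} {Y : Box} {Z : ∀ j, Fin (κ j) → Box}

theorem Step.plug_left {D D' : Diagram X Y} (h : Step D D') (E : ∀ j, Diagram (Z j) (X j)) :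
    Step (D.plug E) (D'.plug E) := by
  obtain ⟨a, x, y, b, h1, h2, hm⟩ := h
  refine ⟨plugWord (fun j => (E j).word) a, _, _, plugWord (fun j => (E j).word) b, ?_, ?_,
    hm.plugWord fun j => (E j).runs⟩
  · simp only [Diagram.plug, h1, plugWord_append]
  · simp only [Diagram.plug, h2, plugWord_append]

theorem plugWord_congr (W W' : ∀ j, List (Layer (κ j))) :
    ∀ w : List (Layer k), (∀ j, boxCount w j ≠ 0 → W j = W' j) → plugWord W w = plugWord W' w
  | [], _ => rfl
  | ⟨p, g⟩ :: w, h => by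
      have ih := plugWord_congr W W' w fun j hj => h j (by
        rw [← List.singleton_append, boxCount_append]; omega)
      simp only [plugWord, List.flatMap_cons] at ih ⊢
      rw [ih]
      congr 1
      cases g with
      | cup => rfl
      | cap => rfl
      | box j => simp only [plugLayer]; rw [h j (by simp [boxCount])]

theorem Step.plug_right (D : Diagram X Y) (E E' : ∀ j, Diagram (Z j) (X j)) (j : Fin k)
    (hj : Step (E j) (E' j)) (hne : ∀ i, i ≠ j → E i = E' i) :
    Step (D.plug E) (D.plug E') := by
  have hD := D.once j
  have hmem : ∃ L ∈ D.word, L.gen = Gen.box j := by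
    have : 0 < boxCount D.word j := by omega
    simpa [boxCount, List.countP_pos_iff] using this
  obtain ⟨⟨p, g⟩, hL, hg⟩ := hmem
  obtain ⟨u, v, huv⟩ := List.append_of_mem hL
  simp only at hg
  subst hg
  have hc : boxCount u j = 0 ∧ boxCount v j = 0 := by
    rw [huv, ← List.singleton_append, boxCount_append, boxCount_append] at hD
    simp only [boxCount, List.countP_singleton, decide_true, if_true] at hD ⊢
    omega
  obtain ⟨a, x, y, b, h1, h2, hm⟩ := hj
  have key : ∀ w : List (Layer k), boxCount w j = 0 →
      plugWord (fun i => (E i).word) w = plugWord (fun i => (E' i).word) w := by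
    intro w hw
    refine plugWord_congr _ _ _ fun i hi => ?_
    have : i ≠ j := by rintro rfl; exact hi hw
    simp only [hne i this]
  have hr : ∀ u v : List (Layer (κ j)), relabel (fun i => finSigmaFinEquiv ⟨j, i⟩) (u ++ v)
      = relabel (fun i => finSigmaFinEquiv ⟨j, i⟩) u
        ++ relabel (fun i => finSigmaFinEquiv ⟨j, i⟩) v := fun u v => List.map_append
  refine ⟨plugWord (fun i => (E i).word) u
      ++ shift p (relabel (fun i => finSigmaFinEquiv ⟨j, i⟩) a), _, _,
    shift p (relabel (fun i => finSigmaFinEquiv ⟨j, i⟩) b) ++ plugWord (fun i => (E i).word) v, ?_, ?_,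
    (hm.relabel (X' := plugBoxes Z) (fun i => finSigmaFinEquiv ⟨j, i⟩)
      fun i => plugBoxes_apply Z j i).shift p⟩
  · simp only [Diagram.plug]
    rw [huv, plugWord_append]
    simp only [plugWord, List.flatMap_cons, plugLayer, h1, hr, shift_append, List.append_assoc]
  · simp only [Diagram.plug]
    rw [huv, plugWord_append, key u hc.1, key v hc.2]
    simp only [plugWord, List.flatMap_cons, plugLayer, h2, hr, shift_append, List.append_assoc]

theorem pod_plug_left {D D' : Diagram X Y} (h : D.pod = D'.pod)
    (E : ∀ j, Diagram (Z j) (X j)) : (D.plug E).pod = (D'.plug E).pod := by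
  have h' := Quot.eqvGen_exact h
  clear h
  induction h' with
  | rel _ _ h => exact Quot.sound (h.plug_left E)
  | refl _ => rfl
  | symm _ _ _ ih => exact ih.symm
  | trans _ _ _ _ _ ih1 ih2 => exact ih1.trans ih2

theorem pod_plug_update (D : Diagram X Y) (E : ∀ j, Diagram (Z j) (X j)) (j : Fin k)
    {F F' : Diagram (Z j) (X j)} (h : F.pod = F'.pod) :
    (D.plug (Function.update E j F)).pod = (D.plug (Function.update E j F')).pod := by
  have h' := Quot.eqvGen_exact h
  clear h
  induction h' with
  | rel F F' h =>
    refine Quot.sound (Step.plug_right D _ _ j (by simpa using h) ?_)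
    intro i hi; simp [hi]
  | refl _ => rfl
  | symm _ _ _ ih => exact ih.symm
  | trans _ _ _ _ _ ih1 ih2 => exact ih1.trans ih2

theorem pod_plug_right (D : Diagram X Y) (E E' : ∀ j, Diagram (Z j) (X j))
    (h : ∀ j, (E j).pod = (E' j).pod) : (D.plug E).pod = (D.plug E').pod := by
  classical
  have key : ∀ s : Finset (Fin k),
      (D.plug E).pod = (D.plug fun j => if j ∈ s then E' j else E j).pod := by
    intro s
    induction s using Finset.induction_on with
    | empty => simp
    | insert a s ha ih =>
      rw [ih]
      have e1 : (fun j => if j ∈ s then E' j else E j)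
          = Function.update (fun j => if j ∈ s then E' j else E j) a (E a) := by
        rw [eq_comm, Function.update_eq_self_iff]; simp [ha]
      have e2 : (fun j => if j ∈ insert a s then E' j else E j)
          = Function.update (fun j => if j ∈ s then E' j else E j) a (E' a) := by
        funext j
        by_cases hj : j = a
        · subst hj; simp
        · simp [hj]
      rw [e2, e1, Function.update_idem]
      exact pod_plug_update D _ a (h a)
  simpa using key Finset.univ

/-- Plugging does not depend on the representatives. -/
theorem Pod.plug_pod (D : Diagram X Y) (E : ∀ j, Diagram (Z j) (X j)) :
    Pod.plug D.pod (fun j => (E j).pod) = (D.plug E).pod := by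
  refine (pod_plug_left (Quot.out_eq _) _).trans (pod_plug_right _ _ _ fun j => ?_)
  exact Quot.out_eq _

end welldefined

/-! ### Representations -/

universe u v

/-- A linear representation (functor to vector spaces and multilinear maps) of the
multicategory with objects `O` and morphisms the alternating pods between the boxes `o X`,
`X : O`. -/
structure Rep (K : Type u) [Field K] {O : Type} (o : O → Box) where
  V : O → Type v
  [addCommGroup : ∀ X, AddCommGroup (V X)]
  [module : ∀ X, Module K (V X)]
  /-- The multilinear map `π_T`. -/
  act : ∀ {k : ℕ} {X : Fin k → O} {Y : O}, Pod (fun i => o (X i)) (o Y) →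
    MultilinearMap K (fun i => V (X i)) (V Y)
  act_id : ∀ (Y : O) (x : Fin 1 → V Y), act (X := fun _ => Y) (Pod.id (o Y)) x = x 0
  act_plug : ∀ {k : ℕ} {X : Fin k → O} {Y : O} {κ : Fin k → ℕ} {Z : ∀ j, Fin (κ j) → O}
    (T : Pod (fun i => o (X i)) (o Y)) (S : ∀ j, Pod (fun i => o (Z j i)) (o (X j)))
    (x : ∀ j i, V (Z j i)),
    act (X := plugBoxes Z) (T.plug S)
        (fun s => x (finSigmaFinEquiv.symm s).1 (finSigmaFinEquiv.symm s).2)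
      = act T fun j => act (S j) (x j)

attribute [instance] Rep.addCommGroup Rep.module

/-- The boxes whose decoration starts with `+`. -/
abbrev PosBox : Type := {X : Box // X.sign = true}

/-- Representations of the multicategory of all alternating pods. -/
abbrev RepAD (K : Type u) [Field K] := Rep.{u, v} K (id : Box → Box)

/-- Representations of the full submulticategory on the boxes whose decoration starts
with `+`. -/
abbrev RepADPos (K : Type u) [Field K] := Rep.{u, v} K (Subtype.val : PosBox → Box)

section

variable {K : Type u} [Field K] {O : Type} {o : O → Box}

/-- `D` consists of `D₀` and one additional anticlockwise loop, bounding a disk that contains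
no other part of the diagram.  The loop is anticlockwise if its left strand goes downwards,
i.e. has sign `-`. -/
def AddsLoop {k : ℕ} {X : Fin k → Box} {Y : Box} (D D₀ : Diagram X Y) : Prop :=
  ∃ a b p, D.word = a ++ [⟨p, Gen.cup⟩, ⟨p, Gen.cap⟩] ++ b ∧ D₀.word = a ++ b ∧
    altSign Y.sign p = false

/-- Anticlockwise loops can be removed at the cost of a factor `d` each. -/
def Rep.LoopsEq (R : Rep.{u, v} K o) (d : K) : Prop :=
  ∀ {k : ℕ} {X : Fin k → O} {Y : O} (D D₀ : Diagram (fun i => o (X i)) (o Y)),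
    AddsLoop D D₀ → R.act D.pod = d • R.act D₀.pod

/-- The linear map given by a pod with one inner box. -/
def Rep.op (R : Rep.{u, v} K o) {X Y : O} (T : Pod (fun _ : Fin 1 => o X) (o Y)) :
    R.V X →ₗ[K] R.V Y :=
  (MultilinearMap.ofSubsingleton K (R.V X) (R.V Y) (0 : Fin 1)).symm (R.act (X := fun _ => X) T)

/-- Isomorphisms of representations: invertible intertwiners. -/
structure Rep.Iso (R R' : Rep.{u, v} K o) where
  equiv : ∀ X, R.V X ≃ₗ[K] R'.V X
  equiv_act : ∀ {k : ℕ} {X : Fin k → O} {Y : O} (T : Pod (fun i => o (X i)) (o Y))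
    (x : ∀ i, R.V (X i)), equiv Y (R.act T x) = R'.act T fun i => equiv (X i) (x i)

/-- Restriction of a representation to the boxes whose decoration starts with `+`. -/
def Rep.restrict (R : RepAD.{u, v} K) : RepADPos.{u, v} K where
  V X := R.V X.1
  act T := R.act T
  act_id Y x := R.act_id Y.1 x
  act_plug T S x := R.act_plug (O := Box) (o := id) T S x

end

/-! ### The pods `1 ⊗ a` and `1 ⊗ C` -/

/-- The box of type `(m, n)` with decoration starting with `-`. -/
abbrev negBox (m n : ℕ) (h : Even (m + n)) : Box := ⟨false, m, n, h⟩

/-- The box of type `(m + 1, n + 1)` with decoration starting with `+`. -/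
abbrev posBox (m n : ℕ) (h : Even (m + n)) : PosBox :=
  ⟨⟨true, m + 1, n + 1, by rw [show m + 1 + (n + 1) = m + n + 2 by ring]; exact h.add even_two⟩,
    rfl⟩

/-- `a ↦ 1 ⊗ a`: an upward vertical string on the left of the inner box. -/
def oneTensor (m n : ℕ) (h : Even (m + n)) :
    Diagram (fun _ : Fin 1 => negBox m n h) (posBox m n h).1 where
  word := [⟨1, Gen.box 0⟩]
  runs := by
    refine ⟨?_, ?_, ?_⟩ <;> simp [Runs, Gen.src, Gen.tgt, Gen.Fits, altSign] <;> omega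
  once := by intro j; simp [boxCount, Subsingleton.elim j 0]

/-- `1 ⊗ C`: an upward vertical string, and on its right the inner box with its leftmost lower
and upper pins connected by an arc that passes on the left of the box. -/
def oneTensorC (m n : ℕ) (h : Even (m + n)) :
    Diagram (fun _ : Fin 1 => (posBox m n h).1) (posBox m n h).1 where
  word := [⟨1, Gen.cup⟩, ⟨2, Gen.box 0⟩, ⟨1, Gen.cap⟩]
  runs := by
    refine ⟨?_, ?_, ?_, ?_, ?_, ?_, ?_⟩ <;>
      simp [Runs, Gen.src, Gen.tgt, Gen.Fits, altSign] <;> omega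
  once := by intro j; simp [boxCount, Subsingleton.elim j 0]

/-- For a representation `E` of all pods whose restriction is identified with `R` by `φ`:
the map `a ↦ 1 ⊗ a` from the `-`-space of type `(m, n)` to the `+`-space of type
`(m + 1, n + 1)`. -/
def embNeg {K : Type u} [Field K] {E : RepAD.{u, v} K} {R : RepADPos.{u, v} K}
    (φ : E.restrict.Iso R) (m n : ℕ) (h : Even (m + n)) :
    E.V (negBox m n h) →ₗ[K] R.V (posBox m n h) :=
  (φ.equiv (posBox m n h)).toLinearMap ∘ₗ E.op (oneTensor m n h).pod

end AltPod

/-!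
A box of sign `-` can be opened, by an upward string on its left, to a box of sign `+`. Closing this
string again on the left of the box gives back the original box together with an anticlockwise
loop, so that up to the factor `d` every box is a retract of a box of sign `+`, the corresponding
idempotent being `d⁻¹ π_{1 ⊗ C}`. An arbitrary pod `T` becomes a pod `T.plus` between boxes of sign
`+` when it is opened on its left and each of its inner boxes is closed on the left. In every
extension the opening maps are injective, their images are the images of these idempotents, and they
turn the action of `T` into the action of `T.plus` divided by `d` once for each inner box of sign
`-`. This proves uniqueness, and existence follows by taking the result as a definition: in a
composite the opening strings of the inner pods are closed off to anticlockwise loops, and the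
division by `d` compensates for these.
-/

namespace AltPod

universe u v

/-! ### Filling inner boxes with words -/

section fill

variable {k l : ℕ}

@[ext]
theorem Diagram.ext {X : Fin k → Box} {Y : Box} {D D' : Diagram X Y} (h : D.word = D'.word) :
    D = D' := by
  cases D; cases D'; cases h; rfl

theorem Diagram.pod_surjective {X : Fin k → Box} {Y : Box} :
    Function.Surjective (Diagram.pod : Diagram X Y → Pod X Y) :=
  Quot.exists_rep

@[simp]
theorem shift_nil (p : ℕ) : shift p ([] : List (Layer k)) = [] := rfl

@[simp]
theorem shift_cons (p q : ℕ) (g : Gen k) (w : List (Layer k)) :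
    shift p (⟨q, g⟩ :: w) = ⟨p + q, g⟩ :: shift p w := rfl

@[simp]
theorem shift_zero (w : List (Layer k)) : shift 0 w = w := by
  simp [shift]

theorem relabel_shift (f : Fin k → Fin l) (p : ℕ) (w : List (Layer k)) :
    relabel f (shift p w) = shift p (relabel f w) := by
  simp [relabel, shift, Function.comp_def]

theorem relabel_cups (f : Fin k → Fin l) (p m : ℕ) : relabel f (cups p m) = cups p m := by
  simp [relabel, cups, Function.comp_def, Gen.relabel]

theorem relabel_caps (f : Fin k → Fin l) (p m : ℕ) : relabel f (caps p m) = caps p m := by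
  simp [relabel, caps, Function.comp_def, Gen.relabel]

/-- The word that a layer becomes when the word `W j` is put into every inner box `j`. In contrast
to `plugLayer`, all the words `W j` are written with the same set of inner boxes. -/
def fillLayer (W : Fin k → List (Layer l)) (L : Layer k) : List (Layer l) :=
  match L.gen with
  | .cup => [⟨L.pos, Gen.cup⟩]
  | .cap => [⟨L.pos, Gen.cap⟩]
  | .box j => shift L.pos (W j)

/-- The word obtained from `w` by putting the word `W j` into every inner box `j`. -/
def fillWord (W : Fin k → List (Layer l)) (w : List (Layer k)) : List (Layer l) :=
  w.flatMap (fillLayer W)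

@[simp]
theorem fillWord_nil (W : Fin k → List (Layer l)) : fillWord W [] = [] := rfl

@[simp]
theorem fillWord_cons (W : Fin k → List (Layer l)) (L : Layer k) (w : List (Layer k)) :
    fillWord W (L :: w) = fillLayer W L ++ fillWord W w := rfl

theorem fillWord_append (W : Fin k → List (Layer l)) (u v : List (Layer k)) :
    fillWord W (u ++ v) = fillWord W u ++ fillWord W v := List.flatMap_append

theorem fillWord_box (w : List (Layer k)) : fillWord (fun j => [⟨0, Gen.box j⟩]) w = w := by
  induction w with
  | nil => rfl
  | cons L w ih => obtain ⟨p, _ | _ | j⟩ := L <;> simp [fillLayer, ih]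

theorem relabel_eq_fillWord (f : Fin k → Fin l) (w : List (Layer k)) :
    relabel f w = fillWord (fun j => [⟨0, Gen.box (f j)⟩]) w := by
  induction w with
  | nil => rfl
  | cons L w ih =>
    obtain ⟨p, _ | _ | j⟩ := L <;> simp [fillLayer, ← ih] <;> rfl

theorem plugWord_eq_fillWord {κ : Fin k → ℕ} (W : ∀ j, List (Layer (κ j))) (w : List (Layer k)) :
    plugWord W w = fillWord (fun j => relabel (fun i => finSigmaFinEquiv ⟨j, i⟩) (W j)) w := rfl

theorem fillWord_shift (W : Fin k → List (Layer l)) (p : ℕ) (w : List (Layer k)) :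
    fillWord W (shift p w) = shift p (fillWord W w) := by
  induction w with
  | nil => rfl
  | cons L w ih =>
    obtain ⟨q, _ | _ | j⟩ := L <;> simp [fillLayer, ih, shift_append, shift_shift]

theorem fillWord_fillWord {m : ℕ} (W : Fin l → List (Layer m)) (V : Fin k → List (Layer l))
    (w : List (Layer k)) : fillWord W (fillWord V w) = fillWord (fun j => fillWord W (V j)) w := by
  induction w with
  | nil => rfl
  | cons L w ih =>
    obtain ⟨q, _ | _ | j⟩ := L <;> simp [fillLayer, ih, fillWord_append, fillWord_shift]

theorem fillWord_eq_relabel_plugWord (W : Fin k → List (Layer l)) (w : List (Layer k)) :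
    fillWord W w = relabel (fun s => (finSigmaFinEquiv.symm s).2) (plugWord W w) := by
  simp [relabel_eq_fillWord, plugWord_eq_fillWord, fillWord_fillWord, fillLayer, fillWord_box]

theorem fillWord_cups (W : Fin k → List (Layer l)) (p m : ℕ) :
    fillWord W (cups p m) = cups p m := by
  rw [fillWord_eq_relabel_plugWord, plugWord_cups, relabel_cups]

theorem fillWord_caps (W : Fin k → List (Layer l)) (p m : ℕ) :
    fillWord W (caps p m) = caps p m := by
  rw [fillWord_eq_relabel_plugWord, plugWord_caps, relabel_caps]

theorem fillWord_congr {W W' : Fin k → List (Layer l)} {w : List (Layer k)}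
    (h : ∀ j, boxCount w j ≠ 0 → W j = W' j) : fillWord W w = fillWord W' w := by
  simp only [fillWord_eq_relabel_plugWord, plugWord_congr W W' w h]

@[simp]
theorem boxCount_nil (j : Fin k) : boxCount ([] : List (Layer k)) j = 0 := rfl

theorem boxCount_cons (L : Layer k) (w : List (Layer k)) (j : Fin k) :
    boxCount (L :: w) j = (if L.gen = Gen.box j then 1 else 0) + boxCount w j := by
  simp [boxCount, List.countP_cons, add_comm]

theorem boxCount_shift (p : ℕ) (w : List (Layer k)) (j : Fin k) :
    boxCount (shift p w) j = boxCount w j := by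
  simp [boxCount, shift, List.countP_map, Function.comp_def]

theorem boxCount_fillWord (W : Fin k → List (Layer l)) (i : Fin l) (w : List (Layer k)) :
    boxCount (fillWord W w) i = ∑ j, boxCount w j * boxCount (W j) i := by
  induction w with
  | nil => simp
  | cons L w ih =>
    obtain ⟨p, _ | _ | j⟩ := L <;>
      simp [fillLayer, boxCount_append, boxCount_shift, boxCount_cons, add_mul,
        Finset.sum_add_distrib, ih]

theorem runs_append_iff {X : Fin k → Box} {ε : Bool} {u v : List (Layer k)} {m l : ℕ} :
    Runs X ε m (u ++ v) l ↔ ∃ n, Runs X ε m u n ∧ Runs X ε n v l := by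
  induction u generalizing m with
  | nil => simp [Runs]
  | cons L u ih => simp [Runs, ih, and_assoc]

theorem runs_fillWord {X : Fin k → Box} {X' : Fin l → Box} {W : Fin k → List (Layer l)}
    (hW : ∀ j, Runs X' (X j).sign (X j).lower (W j) (X j).upper) {ε : Bool} {w : List (Layer k)}
    {m n : ℕ} (h : Runs X ε m w n) : Runs X' ε m (fillWord W w) n := by
  rw [fillWord_eq_relabel_plugWord]
  exact runs_relabel _ (fun _ => rfl) _ _ _ (runs_plugWord (Z := fun _ => X') hW _ _ _ h)

theorem Move.fillWord {X : Fin k → Box} {X' : Fin l → Box} {W : Fin k → List (Layer l)}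
    (hW : ∀ j, Runs X' (X j).sign (X j).lower (W j) (X j).upper) {x y : List (Layer k)}
    (h : Move X x y) : Move X' (AltPod.fillWord W x) (AltPod.fillWord W y) := by
  rw [fillWord_eq_relabel_plugWord, fillWord_eq_relabel_plugWord]
  exact Move.relabel (X := plugBoxes fun _ => X') (fun s => (finSigmaFinEquiv.symm s).2)
    (fun _ => rfl) (h.plugWord hW)

/-- The words `W j` can be put into the inner boxes `X j`, and together they contain each of the
boxes `X' i` exactly once. -/
structure IsFilling (X : Fin k → Box) (X' : Fin l → Box) (W : Fin k → List (Layer l)) :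
    Prop where
  runs : ∀ j, Runs X' (X j).sign (X j).lower (W j) (X j).upper
  once : ∀ i, ∑ j, boxCount (W j) i = 1

variable {X : Fin k → Box} {X' : Fin l → Box} {Y : Box} {W : Fin k → List (Layer l)}

/-- The diagram obtained by putting the words `W j` into the inner boxes of `D`. -/
def Diagram.fill (D : Diagram X Y) (hW : IsFilling X X' W) : Diagram X' Y where
  word := fillWord W D.word
  runs := runs_fillWord hW.runs D.runs
  once i := by simp [boxCount_fillWord, D.once, hW.once]

theorem Step.fill {D D' : Diagram X Y} (h : Step D D') (hW : IsFilling X X' W) :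
    Step (D.fill hW) (D'.fill hW) := by
  obtain ⟨a, x, y, b, hD, hD', hm⟩ := h
  refine ⟨fillWord W a, _, _, fillWord W b, ?_, ?_, hm.fillWord hW.runs⟩
  · simp only [Diagram.fill, hD, fillWord_append]
  · simp only [Diagram.fill, hD', fillWord_append]

theorem IsFilling.of_boxCount_eq {W' : Fin k → List (Layer l)} (hW : IsFilling X X' W)
    (hruns : ∀ j, Runs X' (X j).sign (X j).lower (W' j) (X j).upper)
    (hcount : ∀ j i, boxCount (W' j) i = boxCount (W j) i) : IsFilling X X' W' where
  runs := hruns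
  once i := by simp only [hcount, hW.once]

theorem isFilling_box (X : Fin k → Box) : IsFilling X X fun j => [⟨0, Gen.box j⟩] where
  runs j := by simp [Runs, Gen.src, Gen.tgt, Gen.Fits, altSign]
  once i := by simp [boxCount_cons]

theorem isFilling_relabel {κ : Fin k → ℕ} (e : (Σ j, Fin (κ j)) ≃ Fin l)
    {Z : ∀ j, Fin (κ j) → Box} (E : ∀ j, Diagram (Z j) (X j)) :
    IsFilling X (fun s => Z (e.symm s).1 (e.symm s).2)
      fun j => relabel (fun i => e ⟨j, i⟩) (E j).word where
  runs j := runs_relabel _ (fun i => by rw [e.symm_apply_apply]) _ _ _ (E j).runs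
  once s := by
    simp only [relabel_eq_fillWord, boxCount_fillWord, (E _).once, one_mul, boxCount_cons,
      boxCount_nil, add_zero, Gen.box.injEq]
    rw [← Fintype.sum_sigma' fun j i => if e ⟨j, i⟩ = s then 1 else 0]
    exact (e.sum_comp fun t => if t = s then 1 else 0).trans (by simp)

end fill

/-! ### Opening and closing on the left -/

section trace

variable {k l : ℕ} {X : Fin k → Box} {X' : Fin l → Box} {Y : Box}

theorem altSign_altSign (ε : Bool) (r : ℕ) : altSign (altSign ε r) r = ε := by
  simp [altSign]

theorem boxCount_cups (p r : ℕ) (j : Fin k) : boxCount (cups p r) j = 0 := by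
  simp [boxCount, cups, List.countP_map, Function.comp_def]

theorem boxCount_caps (p r : ℕ) (j : Fin k) : boxCount (caps p r) j = 0 := by
  simp [boxCount, caps, List.countP_map, Function.comp_def]

theorem runs_cups (ε : Bool) {p m : ℕ} (h : p ≤ m) (r : ℕ) :
    Runs X ε m (cups p r) (m + 2 * r) := by
  induction r with
  | zero => simp [cups, Runs]
  | succ r ih =>
    rw [cups, List.range_succ, List.map_append]
    refine runs_append _ _ _ _ _ ih ?_
    simp [Runs, Gen.src, Gen.tgt, Gen.Fits]
    omega

theorem runs_caps (ε : Bool) {p m : ℕ} (h : p ≤ m) (r : ℕ) :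
    Runs X ε (m + 2 * r) (caps p r) m := by
  induction r with
  | zero => simp [caps, Runs]
  | succ r ih =>
    rw [caps, List.range_succ, List.reverse_append, List.map_append]
    refine runs_append _ _ _ (m + 2 * r) _ ?_ ih
    simp [Runs, Gen.src, Gen.tgt, Gen.Fits]
    omega

/-- The left partial trace of `w` along its first `r` strands: they are closed by `r` nested arcs
that pass on the left of `w`. -/
def leftTrace (r : ℕ) (w : List (Layer k)) : List (Layer k) :=
  cups 0 r ++ shift r w ++ caps 0 r

@[simp]
theorem leftTrace_zero (w : List (Layer k)) : leftTrace 0 w = w := by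
  simp [leftTrace, cups, caps]

theorem fillWord_leftTrace (W : Fin k → List (Layer l)) (r : ℕ) (w : List (Layer k)) :
    fillWord W (leftTrace r w) = leftTrace r (fillWord W w) := by
  simp only [leftTrace, fillWord_append, fillWord_shift, fillWord_cups, fillWord_caps]

theorem boxCount_leftTrace (r : ℕ) (w : List (Layer k)) (j : Fin k) :
    boxCount (leftTrace r w) j = boxCount w j := by
  simp [leftTrace, boxCount_append, boxCount_cups, boxCount_caps, boxCount_shift]

theorem runs_leftTrace {ε : Bool} {r m n : ℕ} {w : List (Layer k)}
    (h : Runs X (altSign ε r) (m + r) w (n + r)) : Runs X ε m (leftTrace r w) n := by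
  refine runs_append _ _ _ (n + 2 * r) _ (runs_append _ _ _ (m + 2 * r) _ ?_ ?_) ?_
  · exact runs_cups ε m.zero_le r
  · convert runs_shift r 0 w _ _ h using 1 <;> ring
  · exact runs_caps ε n.zero_le r

/-- The number of strands to be put on the left of a box to make its sign `+`. -/
def Box.offset (X : Box) : ℕ := (!X.sign).toNat

theorem Box.altSign_sign_offset (X : Box) : altSign X.sign X.offset = true := by
  obtain ⟨_ | _, m, n, h⟩ := X <;> simp [altSign, Box.offset]

theorem Box.altSign_true_offset (X : Box) : altSign true X.offset = X.sign := by
  rw [← X.altSign_sign_offset, altSign_altSign]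

/-- The box of sign `+` obtained by putting `X.offset` strands on the left of `X`. -/
def Box.plus (X : Box) : PosBox :=
  ⟨⟨true, X.lower + X.offset, X.upper + X.offset, by
    rw [add_add_add_comm]; exact X.even.add ⟨_, rfl⟩⟩, rfl⟩

/-- The diagram `D` with `Y.offset` strands put on its left. -/
def Diagram.openLeft (D : Diagram X Y) : Diagram X Y.plus.1 where
  word := shift Y.offset D.word
  runs := by
    have h := runs_shift (ε := true) Y.offset 0 D.word _ _ (Y.altSign_true_offset ▸ D.runs)
    rwa [add_zero, add_zero, add_comm Y.offset, add_comm Y.offset] at h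
  once j := by rw [boxCount_shift, D.once]

theorem isFilling_closed (X : Fin k → Box) :
    IsFilling X (fun j => (X j).plus.1) fun j => leftTrace (X j).offset [⟨0, Gen.box j⟩] where
  runs j := runs_leftTrace (by
    rw [Box.altSign_sign_offset]
    exact (isFilling_box fun j => (X j).plus.1).runs j)
  once i := by simp only [boxCount_leftTrace, (isFilling_box X).once]

/-- The diagram `D` with every inner box replaced by the left partial trace of a box of
sign `+`. -/
def Diagram.closeInner (D : Diagram X Y) : Diagram (fun j => (X j).plus.1) Y :=
  D.fill (isFilling_closed X)

theorem Diagram.fillWord_closeInner (D : Diagram X Y) (V : Fin k → List (Layer l)) :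
    fillWord V D.closeInner.word
      = fillWord (fun j => leftTrace (X j).offset (V j)) D.word := by
  simp [closeInner, fill, fillWord_fillWord, fillWord_leftTrace, fillLayer]

/-- The diagram between boxes of sign `+` obtained from `D` by opening it on its left and closing
all its inner boxes on their left. -/
def Diagram.plus (D : Diagram X Y) : Diagram (fun j => (X j).plus.1) Y.plus.1 :=
  D.openLeft.closeInner

theorem Step.openLeft {D D' : Diagram X Y} (h : Step D D') : Step D.openLeft D'.openLeft := by
  obtain ⟨a, x, y, b, hD, hD', hm⟩ := h
  refine ⟨shift Y.offset a, _, _, shift Y.offset b, ?_, ?_, hm.shift Y.offset⟩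
  · simp only [Diagram.openLeft, hD, shift_append]
  · simp only [Diagram.openLeft, hD', shift_append]

/-- The operation `Diagram.plus` on pods. -/
def Pod.plus : Pod X Y → Pod (fun j => (X j).plus.1) Y.plus.1 :=
  Quot.map Diagram.plus fun _ _ h => h.openLeft.fill (isFilling_closed X)

theorem Diagram.pod_plus (D : Diagram X Y) : D.pod.plus = D.plus.pod := rfl

theorem AddsLoop.plus {D D₀ : Diagram X Y} (h : AddsLoop D D₀) : AddsLoop D.plus D₀.plus := by
  obtain ⟨a, b, p, hD, hD₀, hp⟩ := h
  let close (w : List (Layer k)) : List (Layer k) :=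
    fillWord (fun j => leftTrace (X j).offset [⟨0, Gen.box j⟩]) (shift Y.offset w)
  have close_append (u v : List (Layer k)) : close (u ++ v) = close u ++ close v := by
    simp only [close, shift_append, fillWord_append]
  refine ⟨close a, close b, Y.offset + p, ?_, ?_, ?_⟩
  · change close D.word = _
    rw [hD, close_append, close_append]
    rfl
  · change close D₀.word = _
    rw [hD₀, close_append]
  · change altSign true _ = _
    rw [altSign_add, Y.altSign_true_offset, hp]

/-- The diagram `1 ⊗ a` if `X` has sign `-`, and the identity if `X` has sign `+`. -/
def openBox (X : Box) : Diagram (fun _ : Fin 1 => X) X.plus.1 :=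
  (Diagram.id X).openLeft

/-- The left partial trace of a box of sign `+` as a diagram; the identity if `X` has sign `+`. -/
def closeBox (X : Box) : Diagram (fun _ : Fin 1 => X.plus.1) X :=
  (Diagram.id X).closeInner

theorem word_plus_id (X : Box) :
    (Diagram.id X).plus.word = fillWord (fun _ => (closeBox X).word) (openBox X).word := by
  simp [closeBox, openBox, Diagram.plus, Diagram.closeInner, Diagram.fill, Diagram.openLeft,
    Diagram.id, fillLayer]

end trace

/-! ### Removing loops to the left of inner boxes -/

section loops

variable {k l : ℕ} {X : Fin k → Box} {X' : Fin l → Box} {W W' : Fin k → List (Layer l)}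

theorem Diagram.exists_box {Y : Box} (D : Diagram X Y) (j : Fin k) :
    ∃ u p v, D.word = u ++ ⟨p, Gen.box j⟩ :: v ∧ boxCount u j = 0 ∧ boxCount v j = 0 ∧
      altSign Y.sign p = (X j).sign := by
  have hcount := D.once j
  obtain ⟨⟨p, g⟩, hL, rfl⟩ : ∃ L ∈ D.word, L.gen = Gen.box j := by
    simpa [boxCount, List.countP_pos_iff] using hcount.symm.le
  obtain ⟨u, v, hD⟩ := List.append_of_mem hL
  rw [hD, boxCount_append, boxCount_cons, if_pos rfl] at hcount
  obtain ⟨n, -, -, hfits, -⟩ := runs_append_iff.1 (hD ▸ D.runs)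
  exact ⟨u, p, v, hD, by omega, by omega, hfits.symm⟩

theorem Diagram.exists_fillWord_eq {Y : Box} (D : Diagram X Y) (W : Fin k → List (Layer l))
    (j : Fin k) :
    ∃ u p v, altSign Y.sign p = (X j).sign ∧ ∀ W' : Fin k → List (Layer l),
      (∀ i ≠ j, W' i = W i) → fillWord W' D.word = u ++ shift p (W' j) ++ v := by
  obtain ⟨u, p, v, hD, hu, hv, hp⟩ := D.exists_box j
  refine ⟨fillWord W u, p, fillWord W v, hp, fun W' hW' => ?_⟩
  have fillWord_eq {w : List (Layer k)} (hw : boxCount w j = 0) : fillWord W' w = fillWord W w :=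
    fillWord_congr fun i hi => hW' i fun hij => hi (hij ▸ hw)
  rw [hD, fillWord_append, fillWord_cons, fillWord_eq hu, fillWord_eq hv, List.append_assoc]
  rfl

theorem IsFilling.addLoops (hW : IsFilling X X' W) (r : Fin k → ℕ) :
    IsFilling X X' fun j => leftTrace (r j) (shift (r j) (W j)) := by
  refine hW.of_boxCount_eq (fun j => runs_leftTrace ?_) fun j i => ?_
  · have h := runs_shift (r j) 0 _ _ _ ((altSign_altSign (X j).sign (r j)).symm ▸ hW.runs j)
    rwa [add_zero, add_zero, add_comm (r j), add_comm (r j)] at h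
  · rw [boxCount_leftTrace, boxCount_shift]

variable {K : Type u} [Field K] {O : Type} {o : O → Box} {R : Rep.{u, v} K o} {d : K}
  {X' : Fin l → O} {Y : O}

theorem Rep.LoopsEq.act_fill_add_loop (hR : R.LoopsEq d) (D : Diagram X (o Y))
    (hW : IsFilling X (fun i => o (X' i)) W) (hW' : IsFilling X (fun i => o (X' i)) W') (j : Fin k)
    (hj : W' j = leftTrace (X j).offset (shift (X j).offset (W j))) (hne : ∀ i ≠ j, W' i = W i) :
    R.act (D.fill hW').pod = d ^ (X j).offset • R.act (D.fill hW).pod := by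
  obtain hsign | hsign := (X j).sign.eq_false_or_eq_true
  · have hoffset : (X j).offset = 0 := by simp [Box.offset, hsign]
    obtain rfl : W' = W := funext fun i => by
      obtain rfl | hi := eq_or_ne i j
      · simpa [hoffset] using hj
      · exact hne i hi
    rw [hoffset, pow_zero, one_smul]
  have hoffset : (X j).offset = 1 := by simp [Box.offset, hsign]
  obtain ⟨u, p, v, hp, hword⟩ := D.exists_fillWord_eq W j
  -- In `AddsLoop` the arcs of the loop are consecutive layers, so the upper one is first slid
  -- below `W j`.
  let V := Function.update W j (⟨0, Gen.cup⟩ :: ⟨0, Gen.cap⟩ :: W j)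
  have hV : IsFilling X (fun i => o (X' i)) V := by
    refine hW.of_boxCount_eq (fun i => ?_) fun i s => ?_ <;> obtain rfl | hi := eq_or_ne i j
    · simpa [V, Runs, Gen.src, Gen.tgt, Gen.Fits] using hW.runs i
    · simpa [V, hi] using hW.runs i
    · simp [V, boxCount_cons]
    · simp [V, hi]
  have hslide : (D.fill hV).pod = (D.fill hW').pod := by
    refine Quot.sound ⟨u ++ [⟨p, Gen.cup⟩], _, _, v, ?_, ?_,
      Move.slide true [⟨0, Gen.cap⟩] (W j) p 2 0 0 (by simp [Runs, Gen.src, Gen.tgt, Gen.Fits])⟩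
    · simp [Diagram.fill, hword V fun _ hi => Function.update_of_ne hi _ _, V]
    · simp [Diagram.fill, hword W' hne, hj, hoffset, leftTrace, cups, caps, shift_append,
        shift_shift]
  have hloop : AddsLoop (D.fill hV) (D.fill hW) := by
    refine ⟨u, shift p (W j) ++ v, p, ?_, ?_, hp.trans hsign⟩
    · simp [Diagram.fill, hword V fun _ hi => Function.update_of_ne hi _ _, V]
    · simp [Diagram.fill, hword W fun _ _ => rfl]
  rw [hoffset, pow_one, ← hslide, hR _ _ hloop]

theorem Rep.LoopsEq.act_fill_addLoops (hR : R.LoopsEq d) (D : Diagram X (o Y))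
    (hW : IsFilling X (fun i => o (X' i)) W) :
    R.act (D.fill (hW.addLoops fun j => (X j).offset)).pod
      = (∏ j, d ^ (X j).offset) • R.act (D.fill hW).pod := by
  let r (s : Finset (Fin k)) : Fin k → ℕ := s.piecewise (fun j => (X j).offset) 0
  suffices h : ∀ s, R.act (D.fill (hW.addLoops (r s))).pod
      = (∏ j ∈ s, d ^ (X j).offset) • R.act (D.fill hW).pod by
    simpa [r] using h Finset.univ
  intro s
  induction s using Finset.induction_on with
  | empty => simp [r]
  | insert j s hj ih =>
    rw [Finset.prod_insert hj, mul_smul, ← ih]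
    refine hR.act_fill_add_loop D _ _ j ?_ fun i hi => ?_
    · simp [r, hj]
    · simp [r, hi, Finset.piecewise]

end loops

/-! ### Composition in terms of words -/

section comp

variable {K : Type u} [Field K] {O : Type} {o : O → Box} (R : Rep.{u, v} K o)
  {k l : ℕ} {κ : Fin k → ℕ} {X : Fin k → O} {Y : O} {Z : ∀ j, Fin (κ j) → O}

/-- The diagram `F` is `D` with the `E j` plugged in; by `he`, its inner boxes are numbered
lexicographically. With a general `e` it can be applied when `l` is not literally `∑ j, κ j`. -/
theorem Rep.act_comp (e : (Σ j, Fin (κ j)) ≃ Fin l) (he : ∀ p, (e p : ℕ) = finSigmaFinEquiv p)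
    (D : Diagram (fun j => o (X j)) (o Y)) (E : ∀ j, Diagram (fun i => o (Z j i)) (o (X j)))
    (F : Diagram (fun s => o (Z (e.symm s).1 (e.symm s).2)) (o Y))
    (hF : F.word = fillWord (fun j => relabel (fun i => e ⟨j, i⟩) (E j).word) D.word)
    (x : ∀ j i, R.V (Z j i)) :
    R.act F.pod (fun s => x (e.symm s).1 (e.symm s).2)
      = R.act D.pod fun j => R.act (E j).pod (x j) := by
  obtain rfl : ∑ j, κ j = l := by simpa using Fintype.card_congr e
  obtain rfl : e = finSigmaFinEquiv := Equiv.ext fun p => Fin.ext (he p)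
  obtain rfl : F = D.plug E := Diagram.ext hF
  rw [← R.act_plug, Pod.plug_pod]

theorem uniqueSigma_eq_finSigmaFinEquiv (p : Σ _ : Fin 1, Fin k) :
    (Equiv.uniqueSigma (fun _ : Fin 1 => Fin k) p : ℕ) = finSigmaFinEquiv p := by
  obtain ⟨j, i⟩ := p
  obtain rfl : j = default := Subsingleton.elim _ _
  simp [finSigmaFinEquiv_apply, Equiv.uniqueSigma_apply]

theorem relabel_uniqueSigma (j : Fin 1) (w : List (Layer k)) :
    relabel (fun i => Equiv.uniqueSigma (fun _ : Fin 1 => Fin k) ⟨j, i⟩) w = w := by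
  obtain rfl : j = default := Subsingleton.elim _ _
  simp [relabel_eq_fillWord, Equiv.uniqueSigma_apply, fillWord_box]

variable {X₁ X₂ : O}

theorem Rep.op_apply (T : Pod (fun _ : Fin 1 => o X₁) (o X₂)) (a : R.V X₁) :
    R.op T a = R.act (X := fun _ => X₁) T fun _ => a := rfl

theorem Rep.op_act (D : Diagram (fun _ : Fin 1 => o X₁) (o Y))
    (E : Diagram (fun i => o (X i)) (o X₁)) (F : Diagram (fun i => o (X i)) (o Y))
    (hF : F.word = fillWord (fun _ => E.word) D.word) (x : ∀ i, R.V (X i)) :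
    R.op D.pod (R.act E.pod x) = R.act F.pod x := by
  refine (R.act_comp (κ := fun _ => k) (Z := fun _ => X) (X := fun _ => X₁) _
    uniqueSigma_eq_finSigmaFinEquiv D (fun _ => E) F ?_ fun _ => x).symm
  simp only [hF, relabel_uniqueSigma]

theorem Rep.act_op (D : Diagram (fun i => o (X i)) (o Y)) {X' : Fin k → O}
    (E : ∀ j, Diagram (fun _ : Fin 1 => o (X' j)) (o (X j)))
    (F : Diagram (fun i => o (X' i)) (o Y))
    (hF : F.word = fillWord (fun j => relabel (fun _ => j) (E j).word) D.word)
    (x : ∀ i, R.V (X' i)) :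
    R.act D.pod (fun j => R.op (E j).pod (x j)) = R.act F.pod x := by
  refine (R.act_comp (κ := fun _ => 1) (Z := fun j _ => X' j)
    (Equiv.sigmaUnique (Fin k) fun _ => Fin 1) ?_ D E F hF fun j _ => x j).symm
  rintro ⟨j, i⟩
  simp [finSigmaFinEquiv_apply]

theorem Rep.Iso.equiv_op {R R' : Rep.{u, v} K o} (φ : R.Iso R')
    (T : Pod (fun _ : Fin 1 => o X₁) (o X₂)) (a : R.V X₁) :
    φ.equiv X₂ (R.op T a) = R'.op T (φ.equiv X₁ a) :=
  φ.equiv_act (X := fun _ => X₁) T fun _ => a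

end comp

/-! ### The extension -/

section extension

variable {K : Type u} [Field K] {R : RepADPos.{u, v} K} {d : K}

section actPlus

variable {k : ℕ} {X : Fin k → Box} {Y : Box}

variable (R d) in
/-- The action of the pod `T.plus`, normalised by a factor `d⁻¹` for every inner box of sign `-`.
It is compatible with plugging, and the identity pods act by idempotents. -/
def Rep.actPlus (T : Pod X Y) : MultilinearMap K (fun j => R.V (X j).plus) (R.V Y.plus) :=
  (∏ j, (d ^ (X j).offset)⁻¹) • R.act T.plus

theorem Rep.actPlus_comp (hd : d ≠ 0) (hR : R.LoopsEq d) {l : ℕ} {κ : Fin k → ℕ}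
    {Z : ∀ j, Fin (κ j) → Box} (e : (Σ j, Fin (κ j)) ≃ Fin l)
    (he : ∀ p, (e p : ℕ) = finSigmaFinEquiv p) (D : Diagram X Y) (E : ∀ j, Diagram (Z j) (X j))
    (F : Diagram (fun s => Z (e.symm s).1 (e.symm s).2) Y)
    (hF : F.word = fillWord (fun j => relabel (fun i => e ⟨j, i⟩) (E j).word) D.word)
    (x : ∀ j i, R.V (Z j i).plus) :
    R.actPlus d F.pod (fun s => x (e.symm s).1 (e.symm s).2)
      = R.actPlus d D.pod fun j => R.actPlus d (E j).pod (x j) := by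
  have hfill := isFilling_relabel e fun j => (E j).closeInner
  have hoffset (j i) :
      (Z (e.symm (e ⟨j, i⟩)).1 (e.symm (e ⟨j, i⟩)).2).offset = (Z j i).offset := by
    rw [e.symm_apply_apply]
  have hplus : F.plus = D.openLeft.fill hfill := by
    ext1
    simp only [Diagram.plus, Diagram.openLeft, Diagram.closeInner, Diagram.fill, hF,
      ← fillWord_shift, fillWord_fillWord, relabel_eq_fillWord]
    simp [fillLayer, fillWord_leftTrace, hoffset]
  have hcomp : R.act D.plus.pod (fun j => R.act (E j).plus.pod (x j))
      = (∏ j, d ^ (X j).offset) • R.act F.plus.pod fun s => x (e.symm s).1 (e.symm s).2 := by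
    rw [hplus, ← smul_apply, ← hR.act_fill_addLoops]
    refine (R.act_comp e he D.plus (fun j => (E j).plus) _ ?_ x).symm
    simp only [Diagram.plus, Diagram.fillWord_closeInner]
    simp only [Diagram.fill, Diagram.openLeft, Diagram.closeInner, fillWord_shift, relabel_shift]
  have hscalar : ∏ s, (d ^ (Z (e.symm s).1 (e.symm s).2).offset)⁻¹
      = ∏ j, ∏ i, (d ^ (Z j i).offset)⁻¹ := by
    rw [e.symm.prod_comp fun p => (d ^ (Z p.1 p.2).offset)⁻¹, Fintype.prod_sigma]
  have hcancel : (∏ j, (d ^ (X j).offset)⁻¹) * ∏ j, d ^ (X j).offset = 1 := by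
    rw [← Finset.prod_mul_distrib]
    exact Finset.prod_eq_one fun j _ => inv_mul_cancel₀ (pow_ne_zero _ hd)
  simp only [Rep.actPlus, smul_apply, Diagram.pod_plus, MultilinearMap.map_smul_univ,
    hcomp, hscalar]
  rw [smul_comm, smul_smul _ (∏ j, d ^ (X j).offset), hcancel, one_smul]

theorem Rep.LoopsEq.actPlus (hR : R.LoopsEq d) {D D₀ : Diagram X Y} (h : AddsLoop D D₀) :
    R.actPlus d D.pod = d • R.actPlus d D₀.pod := by
  simp only [Rep.actPlus, Diagram.pod_plus, hR _ _ h.plus, smul_comm d]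

variable (R d) in
/-- The idempotent by which the identity pod of `X` acts under `Rep.actPlus`. -/
def Rep.plusProj (X : Box) : R.V X.plus →ₗ[K] R.V X.plus :=
  (d ^ X.offset)⁻¹ • R.op (Pod.id X).plus

theorem Rep.actPlus_id (x : Fin 1 → R.V Y.plus) :
    R.actPlus d (Pod.id Y) x = R.plusProj d Y (x 0) := by
  have hx : x = fun _ => x 0 := funext fun j => by rw [Subsingleton.elim j 0]
  rw [hx]
  simp [Rep.actPlus, Rep.plusProj, Rep.op_apply]

theorem Rep.plusProj_actPlus (hd : d ≠ 0) (hR : R.LoopsEq d) (T : Pod X Y)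
    (x : ∀ j, R.V (X j).plus) : R.plusProj d Y (R.actPlus d T x) = R.actPlus d T x := by
  obtain ⟨D, rfl⟩ := Diagram.pod_surjective T
  rw [← Rep.actPlus_id fun _ => _]
  refine (Rep.actPlus_comp hd hR (κ := fun _ => k) (Z := fun _ => X) _
    uniqueSigma_eq_finSigmaFinEquiv (Diagram.id Y) (fun _ => D) D ?_ fun _ => x).symm
  simp [Diagram.id, fillLayer, relabel_uniqueSigma]

end actPlus

variable (R d) in
/-- The space of the extension of `R` at `X`: the image of the idempotent `Rep.plusProj`, encoded as
its fixed space. -/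
def Rep.extSpace (X : Box) : Submodule K (R.V X.plus) :=
  LinearMap.eqLocus (R.plusProj d X) LinearMap.id

theorem Rep.mem_extSpace {X : Box} {a : R.V X.plus} :
    a ∈ R.extSpace d X ↔ R.plusProj d X a = a := Iff.rfl

theorem Rep.isProj_plusProj (hd : d ≠ 0) (hR : R.LoopsEq d) (X : Box) :
    LinearMap.IsProj (R.extSpace d X) (R.plusProj d X) where
  map_mem b := by
    have h := Rep.plusProj_actPlus hd hR (Pod.id X) fun _ => b
    rwa [Rep.actPlus_id] at h
  map_id _ hb := hb

theorem Rep.plusProj_negBox (m n : ℕ) (h : Even (m + n)) :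
    R.plusProj d (negBox m n h) = d⁻¹ • R.op (oneTensorC m n h).pod :=
  congr_arg (fun c => c⁻¹ • R.op (oneTensorC m n h).pod) (pow_one d)

/-- The extension of `R` to all boxes. -/
noncomputable def Rep.extension (hd : d ≠ 0) (hR : R.LoopsEq d) : RepAD.{u, v} K where
  V X := R.extSpace d X
  act T := ((R.actPlus d T).compLinearMap fun j => (R.extSpace d _).subtype).codRestrict _
    fun x => Rep.plusProj_actPlus hd hR T _
  act_id Y x := Subtype.ext ((Rep.actPlus_id fun j => (x j).1).trans (x 0).2)
  act_plug T S x := by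
    obtain ⟨D, rfl⟩ := Diagram.pod_surjective T
    choose E hE using fun j => Diagram.pod_surjective (S j)
    obtain rfl : (fun j => (E j).pod) = S := funext hE
    rw [Pod.plug_pod]
    exact Subtype.ext (Rep.actPlus_comp hd hR finSigmaFinEquiv (fun _ => rfl) D E (D.plug E) rfl
      fun j i => (x j i).1)

theorem Rep.extension_loopsEq (hd : d ≠ 0) (hR : R.LoopsEq d) :
    (Rep.extension hd hR).LoopsEq d := fun _ _ h =>
  MultilinearMap.ext fun x => Subtype.ext (DFunLike.congr_fun (hR.actPlus h) fun j => (x j).1)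

theorem PosBox.offset_eq_zero (X : PosBox) : X.1.offset = 0 := by
  simp [Box.offset, X.2]

theorem Rep.op_closeBox_op_openBox (X : PosBox) (a : R.V X) :
    R.op (closeBox X.1).pod (R.op (Y := X.1.plus) (openBox X.1).pod a) = a := by
  refine (R.op_act (closeBox X.1) (openBox X.1) (Diagram.id X.1) ?_ _).trans
    (R.act_id X fun _ => a)
  simp [closeBox, openBox, Diagram.fillWord_closeInner, Diagram.openLeft, Diagram.id, fillLayer,
    X.offset_eq_zero]

theorem Rep.op_openBox_op_closeBox (X : PosBox) (b : R.V X.1.plus) :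
    R.op (openBox X.1).pod (R.op (Y := X) (closeBox X.1).pod b) = R.plusProj d X.1 b := by
  rw [Rep.plusProj, X.offset_eq_zero, pow_zero, inv_one, one_smul]
  exact R.op_act (openBox X.1) (closeBox X.1) (Diagram.id X.1).plus (word_plus_id X.1) _

theorem Rep.op_closeBox_act_plus {k : ℕ} {X : Fin k → Box} {Y : PosBox} (D : Diagram X Y.1)
    (x : ∀ j, R.V (X j).plus) :
    R.op (closeBox Y.1).pod (R.act D.plus.pod x) = R.act D.closeInner.pod x := by
  refine R.op_act (closeBox Y.1) D.plus D.closeInner ?_ x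
  simp [closeBox, Diagram.plus, Diagram.closeInner, Diagram.fill,
    Diagram.openLeft, Diagram.id, fillLayer, Y.offset_eq_zero]

theorem Rep.act_op_closeBox {k : ℕ} {X : Fin k → PosBox} {Y : PosBox}
    (D : Diagram (fun j => (X j).1) Y.1) (x : ∀ j, R.V (X j).1.plus) :
    R.act D.pod (fun j => R.op (closeBox (X j).1).pod (x j)) = R.act D.closeInner.pod x := by
  refine R.act_op D (fun j => closeBox (X j).1) D.closeInner ?_ x
  simp [closeBox, Diagram.closeInner, Diagram.fill, Diagram.id, fillLayer, relabel_eq_fillWord,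
    fillWord_leftTrace]

/-- The spaces of `Rep.extension` at boxes of sign `+` are those of `R`, because there the diagrams
`openBox` and `closeBox` are inverse to each other. -/
noncomputable def Rep.extensionIso (hd : d ≠ 0) (hR : R.LoopsEq d) :
    (Rep.extension hd hR).restrict.Iso R where
  equiv X := LinearEquiv.ofLinearMap (R.op (closeBox X.1).pod ∘ₗ (R.extSpace d X.1).subtype)
    ((R.op (openBox X.1).pod).codRestrict _ fun a => by
      rw [Rep.mem_extSpace, ← Rep.op_openBox_op_closeBox, Rep.op_closeBox_op_openBox])
    (LinearMap.ext fun a => Rep.op_closeBox_op_openBox X a)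
    (LinearMap.ext fun b => Subtype.ext ((Rep.op_openBox_op_closeBox X b.1).trans b.2))
  equiv_act {k X Y} T x := by
    obtain ⟨D, rfl⟩ := Diagram.pod_surjective T
    have hact : R.actPlus d D.pod = R.act D.plus.pod := by
      simp [Rep.actPlus, PosBox.offset_eq_zero, Diagram.pod_plus]
    change R.op (closeBox Y.1).pod (R.actPlus d D.pod fun j => (x j).1)
      = R.act D.pod fun j => R.op (closeBox (X j).1).pod (x j).1
    rw [hact, Rep.op_closeBox_act_plus, Rep.act_op_closeBox]

end extension

/-! ### Uniqueness of the extension -/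

section uniqueness

variable {K : Type u} [Field K] {R : RepADPos.{u, v} K} {E E' : RepAD.{u, v} K} {d : K}
  {k : ℕ} {X : Fin k → Box} {Y : Box}

/-- The map `a ↦ 1 ⊗ a` (that is, `embNeg`) for a box `Y` of sign `-`; for a box of sign `+` no
string is added. -/
def openMap (φ : E.restrict.Iso R) (Y : Box) : E.V Y →ₗ[K] R.V Y.plus :=
  (φ.equiv Y.plus).toLinearMap ∘ₗ E.op (openBox Y).pod

theorem Rep.act_closeInner_op_openBox (hE : E.LoopsEq d) (D : Diagram X Y)
    (x : ∀ j, E.V (X j)) :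
    E.act (X := fun j => (X j).plus.1) D.closeInner.pod (fun j => E.op (openBox (X j)).pod (x j))
      = (∏ j, d ^ (X j).offset) • E.act D.pod x := by
  have hbox : D.fill (isFilling_box X) = D := Diagram.ext (fillWord_box D.word)
  rw [← smul_apply, ← congr_arg Diagram.pod hbox, ← Rep.LoopsEq.act_fill_addLoops hE]
  refine E.act_op (X := fun j => (X j).plus.1) D.closeInner (fun j => openBox (X j)) _ ?_ x
  simp [Diagram.fillWord_closeInner, Diagram.fill, openBox, Diagram.openLeft, Diagram.id,
    relabel_eq_fillWord, fillLayer]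

theorem Rep.op_closeBox_op_openBox_eq_smul (hE : E.LoopsEq d) (a : E.V Y) :
    E.op (X := Y.plus.1) (closeBox Y).pod (E.op (openBox Y).pod a) = d ^ Y.offset • a := by
  have h := Rep.act_closeInner_op_openBox hE (Diagram.id Y) fun _ => a
  rw [Fin.prod_univ_one] at h
  exact h.trans (congr_arg _ (E.act_id Y fun _ => a))

theorem openMap_injective (hd : d ≠ 0) (φ : E.restrict.Iso R) (hE : E.LoopsEq d) (Y : Box) :
    Function.Injective (openMap φ Y) := by
  refine (φ.equiv Y.plus).injective.comp fun a b hab => ?_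
  have h := congr_arg (E.op (X := Y.plus.1) (closeBox Y).pod) hab
  have hclose := Rep.op_closeBox_op_openBox_eq_smul (Y := Y) hE
  exact smul_right_injective _ (pow_ne_zero _ hd) ((hclose a).symm.trans (h.trans (hclose b)))

theorem openMap_act (hd : d ≠ 0) (φ : E.restrict.Iso R) (hE : E.LoopsEq d) (T : Pod X Y)
    (x : ∀ j, E.V (X j)) :
    openMap φ Y (E.act T x) = R.actPlus d T fun j => openMap φ (X j) (x j) := by
  obtain ⟨D, rfl⟩ := Diagram.pod_surjective T
  have hopen : E.op (openBox Y).pod (E.act D.pod x) = E.act D.openLeft.pod x :=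
    E.op_act (openBox Y) D D.openLeft (by simp [openBox, Diagram.openLeft, Diagram.id, fillLayer]) x
  have hplus : E.act D.openLeft.pod x = (∏ j, (d ^ (X j).offset)⁻¹) •
      E.act (X := fun j => (X j).plus.1) D.plus.pod
        fun j => E.op (openBox (X j)).pod (x j) := by
    rw [Finset.prod_inv_distrib, eq_inv_smul_iff₀
      (Finset.prod_ne_zero_iff.2 fun j _ => pow_ne_zero _ hd)]
    exact (Rep.act_closeInner_op_openBox hE D.openLeft x).symm
  calc
    openMap φ Y (E.act D.pod x) = φ.equiv Y.plus (E.act D.openLeft.pod x) := congr_arg _ hopen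
    _ = (∏ j, (d ^ (X j).offset)⁻¹) • φ.equiv Y.plus
          (E.act (X := fun j => (X j).plus.1) D.plus.pod fun j => E.op (openBox (X j)).pod (x j)) :=
      (congr_arg _ hplus).trans (map_smul _ _ _)
    _ = R.actPlus d D.pod fun j => openMap φ (X j) (x j) :=
      congr_arg _ (φ.equiv_act D.plus.pod fun j => E.op (openBox (X j)).pod (x j))

theorem range_openMap (hd : d ≠ 0) (φ : E.restrict.Iso R) (hE : E.LoopsEq d) (Y : Box) :
    LinearMap.range (openMap φ Y) = R.extSpace d Y := by
  refine le_antisymm ?_ fun b hb => ?_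
  · rintro _ ⟨a, rfl⟩
    have h := openMap_act hd φ hE (Pod.id Y) fun _ => a
    rw [Rep.actPlus_id] at h
    exact h.symm.trans (congr_arg _ (E.act_id Y fun _ => a))
  · obtain ⟨b, rfl⟩ := (φ.equiv Y.plus).surjective b
    have hop : E.op (X := Y.plus.1) (Y := Y.plus.1) (Diagram.id Y).plus.pod b
        = E.op (openBox Y).pod (E.op (X := Y.plus.1) (closeBox Y).pod b) :=
      (E.op_act (openBox Y) (closeBox Y) (Diagram.id Y).plus (word_plus_id Y) _).symm
    rw [← Rep.mem_extSpace.1 hb]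
    refine Submodule.smul_mem _ _ ⟨E.op (X := Y.plus.1) (closeBox Y).pod b, ?_⟩
    exact (congr_arg _ hop.symm).trans (φ.equiv_op (Pod.id Y).plus b)

@[ext]
theorem Rep.Iso.ext {O : Type} {o : O → Box} {S S' : Rep.{u, v} K o} {φ φ' : S.Iso S'}
    (h : ∀ X a, φ.equiv X a = φ'.equiv X a) : φ = φ' := by
  cases φ; cases φ'
  congr
  exact funext fun X => LinearEquiv.ext (h X)

theorem openMap_posBox (φ : E.restrict.Iso R) (X : PosBox) (a : E.V X.1) :
    openMap φ X.1 a = R.op (openBox X.1).pod (φ.equiv X a) :=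
  φ.equiv_op (openBox X.1).pod a

theorem forall_equiv_eq_iff_openMap (φ : E.restrict.Iso R) (φ' : E'.restrict.Iso R)
    (ψ : E.Iso E') :
    (∀ (X : PosBox) (a : E.V X.1), φ'.equiv X (ψ.equiv X.1 a) = φ.equiv X a) ↔
      ∀ (Y : Box) (a : E.V Y), openMap φ' Y (ψ.equiv Y a) = openMap φ Y a := by
  refine ⟨fun h Y a => ?_, fun h X a => ?_⟩
  · exact (congr_arg _ (ψ.equiv_op (openBox Y).pod a).symm).trans (h Y.plus _)
  · have hX := h X.1 a
    rw [openMap_posBox, openMap_posBox] at hX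
    exact (Function.LeftInverse.injective (Rep.op_closeBox_op_openBox X)) hX

theorem existsUnique_iso (hd : d ≠ 0) (φ : E.restrict.Iso R) (hE : E.LoopsEq d)
    (φ' : E'.restrict.Iso R) (hE' : E'.LoopsEq d) :
    ∃! ψ : E.Iso E', ∀ (X : PosBox) (a : E.V X.1),
      φ'.equiv X (ψ.equiv X.1 a) = φ.equiv X a := by
  have hinj := openMap_injective hd φ hE
  have hinj' := openMap_injective hd φ' hE'
  have hrange (Y : Box) : LinearMap.range (openMap φ Y) = LinearMap.range (openMap φ' Y) :=
    (range_openMap hd φ hE Y).trans (range_openMap hd φ' hE' Y).symm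
  let e (Y : Box) : E.V Y ≃ₗ[K] E'.V Y :=
    (LinearEquiv.ofInjective _ (hinj Y)).trans <|
      (LinearEquiv.ofEq _ _ (hrange Y)).trans (LinearEquiv.ofInjective _ (hinj' Y)).symm
  have he (Y : Box) (a : E.V Y) : openMap φ' Y (e Y a) = openMap φ Y a :=
    congr_arg Subtype.val ((LinearEquiv.ofInjective _ (hinj' Y)).apply_symm_apply _)
  let ψ : E.Iso E' :=
    { equiv := e
      equiv_act := fun {k X Y} T x => hinj' Y <| by
        rw [he, openMap_act hd φ hE, openMap_act hd φ' hE']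
        simp only [he] }
  refine ⟨ψ, (forall_equiv_eq_iff_openMap φ φ' ψ).2 he, fun ψ' hψ' => ?_⟩
  ext Y a
  exact hinj' Y (((forall_equiv_eq_iff_openMap φ φ' ψ').1 hψ' Y a).trans (he Y a).symm)

theorem isProj_range_embNeg (hd : d ≠ 0) (hR : R.LoopsEq d) (φ : E.restrict.Iso R)
    (hE : E.LoopsEq d) (m n : ℕ) (h : Even (m + n)) :
    LinearMap.IsProj (LinearMap.range (embNeg φ m n h)) (d⁻¹ • R.op (oneTensorC m n h).pod) := by
  have hproj := Rep.isProj_plusProj hd hR (negBox m n h)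
  rwa [← range_openMap hd φ hE, Rep.plusProj_negBox] at hproj

end uniqueness

end AltPod

open AltPod in
/-- Let `R` be a representation of the multicategory of `+`-starting alternating pods in which
anticlockwise loops have the value `d ≠ 0`. Then `R` extends to a representation `E` of all
alternating pods with the same property, the `-`-spaces of `E` are realized as the images of the
projections `d⁻¹ π_{1 ⊗ C}`, and any other such extension is isomorphic to `E` by a unique
isomorphism that is compatible with the identifications on the `+`-part. -/
theorem mainTheorem5 {K : Type*} [Field K] (d : K) (hd : d ≠ 0)
    (R : RepADPos K) (hR : R.LoopsEq d) :
    ∃ (E : RepAD K) (φ : E.restrict.Iso R), E.LoopsEq d ∧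
      (∀ (m n : ℕ) (h : Even (m + n)),
        Function.Injective (embNeg φ m n h) ∧
          LinearMap.IsProj (LinearMap.range (embNeg φ m n h))
            (d⁻¹ • R.op (oneTensorC m n h).pod)) ∧
      ∀ (E' : RepAD K) (φ' : E'.restrict.Iso R), E'.LoopsEq d →
        ∃! ψ : E.Iso E', ∀ (X : PosBox) (a : E.V X.1),
          φ'.equiv X (ψ.equiv X.1 a) = φ.equiv X a := by
  let E := Rep.extension hd hR
  let φ : E.restrict.Iso R := Rep.extensionIso hd hR
  have hE : E.LoopsEq d := Rep.extension_loopsEq hd hR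
  refine ⟨E, φ, hE, fun m n h => ⟨?_, ?_⟩, fun E' φ' hE' => existsUnique_iso hd φ hE φ' hE'⟩
  · exact openMap_injective hd φ hE (negBox m n h)
  · exact isProj_range_embNeg hd hR φ hE m n h
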